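/- Let formulas be generated from $\bot$ and countably infinitely many propositional variables by $A\to B$, $\Box A$ and $A\rhd B$, with $\neg,\vee,\wedge$ defined as usual and $\Diamond A:=\neg\Box\neg A$. Let $\mathbf{ILM}$ be the smallest set of formulas that is closed under modus ponens and necessitation (from $A$ infer $\Box A$) and contains all propositionally tautological formulas and all instances of - $\mathsf{L1}$: $\Box(A\to B)\to(\Box A\to\Box B)$; - $\mathsf{L2}$: $\Box A\to\Box\Box A$; - $\mathsf{L3}$: $\Box(\Box A\to A)\to\Box A$; - $\mathsf{J1}$: $\Box(A\to B)\to (A\rhd B)$; - $\mathsf{J2}$: $(A\rhd B)\wedge(B\rhd C)\to (A\rhd C)$; - $\mathsf{J3}$: $(A\rhd C)\wedge(B\rhd C)\to ((A\vee B)\rhd C)$; - $\mathsf{J4}$: $(A\rhd B)\to(\Diamond A\to\Diamond B)$; - $\mathsf{J5}$: $\Diamond A\rhd A$; - Montagna's principle $\mathsf{M}$: $(A\rhd B)\to ((A\wedge\Box C)\rhd (B\wedge\Box C))$. A Veltman frame $\langle W,R,S\rangle$ consists of a non-empty countable set $W$, a transitive binary relation $R$ on $W$ such that every non-empty subset of $W$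 has an $R$-maximal element, and a transitive binary relation $S_x$ on $W$ for each $x\in W$, such that: $yS_xz$ implies $xRy$ and $xRz$; $xRy$ implies $yS_xy$; and $xRyRz$ implies $yS_xz$. It is an $\mathbf{ILM}$-frame if $yS_xzRu$ implies $yRu$ for all $x,y,z,u\in W$. A valuation assigns truth values to the propositional variables at each world. Truth at a world extends to all formulas by the usual clauses for $\bot$ and $\to$ together with: $w\Vdash\Box A$ iff $v\Vdash A$ for all $v$ with $wRv$; and $w\Vdash A\rhd B$ iff for every $u$ with $wRu$ and $u\Vdash A$ there is $v$ with $uS_wv$ and $v\Vdash B$. A formula is valid on a frame if it is true at every world under every valuation. **Theorem.** $\mathbf{ILM}$ is (sound and) complete with respect to $\mathbf{ILM}$-frames: for every formula $A$, $A\in\mathbf{ILM}$ if and only if $A$ is valid on every $\mathbf{ILM}$-frame. -/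

import Mathlib

namespace InterpretabilityLogic

/-- Formulas of the language of interpretability logic, over the countably infinite set of
propositional variables indexed by `ℕ`. The formula `rhd A B` is read `A ▷ B`. -/
inductive Form : Type
  | bot : Form
  | var : ℕ → Form
  | imp : Form → Form → Form
  | box : Form → Form
  | rhd : Form → Form → Form

namespace Form

/-- Negation `¬A`. -/
def neg (A : Form) : Form := imp A bot

/-- Disjunction `A ∨ B`. -/
def disj (A B : Form) : Form := imp (neg A) B

/-- Conjunction `A ∧ B`. -/
def conj (A B : Form) : Form := neg (imp A (neg B))

/-- The diamond `◇A`, that is `¬□¬A`. -/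
def dia (A : Form) : Form := neg (box (neg A))

/-- Classical truth of a formula under an assignment `v` of truth values to the formulas that are
not `⊥` or an implication: variables, boxed formulas and `▷`-formulas all count as atoms. -/
def Holds (v : Form → Prop) : Form → Prop
  | bot => False
  | var p => v (var p)
  | imp A B => Holds v A → Holds v B
  | box A => v (box A)
  | rhd A B => v (rhd A B)

/-- Tautological formulas: substitution instances of classical propositional tautologies. -/
def IsTautology (A : Form) : Prop := ∀ v : Form → Prop, Holds v A

end Form

open Form

/-- Derivability in `IL` extended by the set `X` of axioms: the smallest set of formulas that
contains all tautological formulas, all instances of `L1`-`L3` and `J1`-`J5` and all elements of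
`X`, and is closed under modus ponens and necessitation. -/
inductive ILX (X : Set Form) : Form → Prop
  | taut {A : Form} : IsTautology A → ILX X A
  | extra {A : Form} : A ∈ X → ILX X A
  | L1 (A B : Form) : ILX X (imp (box (imp A B)) (imp (box A) (box B)))
  | L2 (A : Form) : ILX X (imp (box A) (box (box A)))
  | L3 (A : Form) : ILX X (imp (box (imp (box A) A)) (box A))
  | J1 (A B : Form) : ILX X (imp (box (imp A B)) (rhd A B))
  | J2 (A B C : Form) : ILX X (imp (conj (rhd A B) (rhd B C)) (rhd A C))
  | J3 (A B C : Form) : ILX X (imp (conj (rhd A C) (rhd B C)) (rhd (disj A B) C))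
  | J4 (A B : Form) : ILX X (imp (rhd A B) (imp (dia A) (dia B)))
  | J5 (A : Form) : ILX X (rhd (dia A) A)
  | mp {A B : Form} : ILX X (imp A B) → ILX X A → ILX X B
  | nec {A : Form} : ILX X A → ILX X (box A)

/-- The instances of Montagna's principle `A ▷ B → A ∧ □C ▷ B ∧ □C`. -/
def montagna : Set Form :=
  {F | ∃ A B C : Form, F = imp (rhd A B) (rhd (conj A (box C)) (conj B (box C)))}

/-- Derivability in the logic `ILM`. -/
def ILM (A : Form) : Prop := ILX montagna A

/-- `IL`-frames (Veltman frames). `S x y z` is read `y S_x z`. -/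
structure ILFrame where
  /-- The universe. As it is countable, taking it in the lowest universe is no restriction. -/
  W : Type
  nonempty : Nonempty W
  countable : Countable W
  R : W → W → Prop
  S : W → W → W → Prop
  /-- `R` is conversely well-founded: every non-empty set of worlds has an `R`-maximal element. -/
  conv_wf : ∀ U : Set W, U.Nonempty → ∃ m ∈ U, ∀ x ∈ U, ¬ R m x
  R_trans : ∀ x y z, R x y → R y z → R x z
  S_dom : ∀ x y z, S x y z → R x y ∧ R x z
  S_refl : ∀ x y, R x y → S x y y
  S_incl : ∀ x y z, R x y → R y z → S x y z
  S_trans : ∀ x u v w, S x u v → S x v w → S x u w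

namespace ILFrame

/-- Truth of a formula at the world `w` of the model given by the frame `F` and the valuation
`V`, where `V w p` says that the variable `p` is true at `w`. -/
def Forces (F : ILFrame) (V : F.W → ℕ → Prop) : F.W → Form → Prop
  | _, bot => False
  | w, var p => V w p
  | w, imp A B => F.Forces V w A → F.Forces V w B
  | w, box A => ∀ v, F.R w v → F.Forces V v A
  | w, rhd A B =>
      ∀ u, F.R w u → F.Forces V u A → ∃ v, F.S w u v ∧ F.Forces V v B

/-- Validity on a frame: truth at every world under every valuation. -/
def Valid (F : ILFrame) (A : Form) : Prop :=
  ∀ (V : F.W → ℕ → Prop) (w : F.W), F.Forces V w A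

/-- The frame condition of `ILM`: if `y S_x z R u` then `y R u`. -/
def IsILMFrame (F : ILFrame) : Prop :=
  ∀ x y z u : F.W, F.S x y z → F.R z u → F.R y u

end ILFrame

end InterpretabilityLogic

/-! Soundness is an induction on derivations; the frame condition is what preserves `□C` along `S_x`
and so validates Montagna's principle.

For completeness, a maximal consistent theory omitting the formula is unravelled into a tree. A node
`step p y B C` sits above `y` in the tree order `Le`, but counts as an `R`-successor only of the
nodes `x` with `Le x p`. Taking `S_x` to be the tree order among the successors of `x` makes the ILM
condition mere transitivity of `Le`. The theory of the new node must contain `B` and `□¬B`, keep all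
boxes of `y`, and be `C`-critical over `p`; `exists_realizes` supplies it, and Montagna's principle
allows all boxes of `y` to be kept.

If `A ▷ C` fails at `x`, the node `step x x A C` refutes it: every successor of `x` above that node
is still `C`-critical (`Acc.critical`), so it omits `C`. If `A ▷ B` holds at `x` and `A` at a
successor `u`, then a node `step x u B C` makes `B` true, where `C` is the formula that the branch
below `u` already avoids. Only finitely many `B` are ever realized and each `R`-step makes a new
`□¬B` true, so `R` is conversely well-founded. -/

namespace InterpretabilityLogic

open Form

/-! ### Soundness -/

namespace ILFrame

variable {F : ILFrame} {V : F.W → ℕ → Prop} {w : F.W}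

theorem forces_holds (A : Form) : Holds (F.Forces V w) A ↔ F.Forces V w A := by
  induction A with
  | imp A B ihA ihB => simp only [Holds, Forces, ihA, ihB]
  | _ => simp [Holds, Forces]

theorem forces_conj {A B : Form} :
    F.Forces V w (conj A B) ↔ F.Forces V w A ∧ F.Forces V w B := by
  simp only [conj, neg, Forces]; tauto

theorem forces_disj {A B : Form} :
    F.Forces V w (disj A B) ↔ F.Forces V w A ∨ F.Forces V w B := by
  simp only [disj, neg, Forces]; tauto

theorem forces_dia {A : Form} :
    F.Forces V w (dia A) ↔ ∃ v, F.R w v ∧ F.Forces V v A := by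
  simp only [dia, neg, Forces, imp_false, not_forall, not_not, exists_prop]

theorem valid_of_ilm (hF : F.IsILMFrame) {A : Form} (h : ILM A) : F.Valid A := by
  unfold ILM at h
  induction h with
  | taut h => exact fun V w => (forces_holds _).1 (h _)
  | extra h =>
    obtain ⟨A, B, C, rfl⟩ := h
    intro V w h u hwu hu
    rw [forces_conj] at hu
    obtain ⟨v, huv, hv⟩ := h u hwu hu.1
    exact ⟨v, huv, forces_conj.2 ⟨hv, fun t ht => hu.2 t (hF _ _ _ _ huv ht)⟩⟩
  | L1 A B => exact fun V w h h' v hv => h v hv (h' v hv)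
  | L2 A => exact fun V w h v hv u hu => h u (F.R_trans _ _ _ hv hu)
  | L3 A =>
    intro V w h v hv
    by_contra hA
    obtain ⟨m, ⟨hwm, hm⟩, hmax⟩ :=
      F.conv_wf {u | F.R w u ∧ ¬ F.Forces V u A} ⟨v, hv, hA⟩
    refine hm (h m hwm fun u hu => ?_)
    by_contra hu'
    exact hmax u ⟨F.R_trans _ _ _ hwm hu, hu'⟩ hu
  | J1 A B => exact fun V w h u hu hA => ⟨u, F.S_refl _ _ hu, h u hu hA⟩
  | J2 A B C =>
    intro V w h u hu hA
    obtain ⟨h₁, h₂⟩ := forces_conj.1 h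
    obtain ⟨v, huv, hv⟩ := h₁ u hu hA
    obtain ⟨t, hvt, ht⟩ := h₂ v (F.S_dom _ _ _ huv).2 hv
    exact ⟨t, F.S_trans _ _ _ _ huv hvt, ht⟩
  | J3 A B C =>
    intro V w h u hu hAB
    obtain ⟨h₁, h₂⟩ := forces_conj.1 h
    exact (forces_disj.1 hAB).elim (h₁ u hu) (h₂ u hu)
  | J4 A B =>
    intro V w h hA
    obtain ⟨u, hu, hA⟩ := forces_dia.1 hA
    obtain ⟨v, huv, hv⟩ := h u hu hA
    exact forces_dia.2 ⟨v, (F.S_dom _ _ _ huv).2, hv⟩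
  | J5 A =>
    intro V w u hu hA
    obtain ⟨v, huv, hv⟩ := forces_dia.1 hA
    exact ⟨v, F.S_incl _ _ _ hu huv, hv⟩
  | mp _ _ ih₁ ih₂ => exact fun V w => ih₁ V w (ih₂ V w)
  | nec _ ih => exact fun V _ v _ => ih V v

end ILFrame

/-! ### Theories and maximal consistent theories -/

/-- A set of formulas containing the theorems of `ILM` and closed under modus ponens. -/
structure IsTheory (T : Set Form) : Prop where
  ilm : ∀ {A}, ILM A → A ∈ T
  mp : ∀ {A B}, imp A B ∈ T → A ∈ T → B ∈ T

/-- A maximal consistent theory. -/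
structure IsMaxTheory (T : Set Form) : Prop extends IsTheory T where
  bot_notMem : bot ∉ T
  mem_or_neg : ∀ A, A ∈ T ∨ neg A ∈ T

theorem IsTheory.adjoin {T : Set Form} (hT : IsTheory T) (A : Form) :
    IsTheory {F | imp A F ∈ T} where
  ilm {F} h := hT.mp (hT.ilm (.taut fun v => by simp only [Holds]; tauto)) (hT.ilm h)
  mp {F G} h h' := by
    refine hT.mp (hT.mp (A := imp A (imp F G)) (hT.ilm (.taut fun v => ?_)) h) h'
    simp only [Holds]; tauto

/-- Lindenbaum's lemma. -/
theorem IsTheory.exists_max {T : Set Form} (hT : IsTheory T) (hbot : bot ∉ T) :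
    ∃ M, IsMaxTheory M ∧ T ⊆ M := by
  obtain ⟨M, hTM, hM⟩ := zorn_subset_nonempty {U | IsTheory U ∧ bot ∉ U} (by
    intro c hc hchain ⟨U₀, hU₀⟩
    refine ⟨⋃₀ c, ⟨⟨fun h => ⟨U₀, hU₀, (hc hU₀).1.ilm h⟩, ?_⟩, ?_⟩,
      fun U hU => Set.subset_sUnion_of_mem hU⟩
    · rintro A B ⟨U, hU, h⟩ ⟨U', hU', h'⟩
      rcases hchain.total hU hU' with hs | hs
      · exact ⟨U', hU', (hc hU').1.mp (hs h) h'⟩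
      · exact ⟨U, hU, (hc hU).1.mp h (hs h')⟩
    · rintro ⟨U, hU, h⟩
      exact (hc hU).2 h) T ⟨hT, hbot⟩
  have hMT := hM.prop.1
  refine ⟨M, ⟨hMT, hM.prop.2, fun A => ?_⟩, hTM⟩
  by_cases hA : neg A ∈ M
  · exact .inr hA
  · refine .inl (hM.le_of_ge ⟨hMT.adjoin A, hA⟩ (fun F hF => ?_) ?_)
    · exact hMT.mp (hMT.ilm (.taut fun v => by simp only [Holds]; tauto)) hF
    · exact hMT.ilm (.taut fun v => by simp only [Holds]; tauto)

theorem isTheory_ilm : IsTheory {A | ILM A} := ⟨id, .mp⟩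

namespace IsMaxTheory

variable {T : Set Form} {A B C : Form}

theorem mem_imp (hT : IsMaxTheory T) : imp A B ∈ T ↔ (A ∈ T → B ∈ T) := by
  refine ⟨hT.mp, fun h => ?_⟩
  rcases hT.mem_or_neg A with hA | hA
  · exact hT.mp (hT.ilm (.taut fun v => by simp only [Holds]; tauto)) (h hA)
  · exact hT.mp (hT.ilm (.taut fun v => by simp only [neg, Holds]; tauto)) hA

theorem mem_neg (hT : IsMaxTheory T) : neg A ∈ T ↔ A ∉ T := by
  simp only [neg, hT.mem_imp, hT.bot_notMem, imp_false]

theorem mem_conj (hT : IsMaxTheory T) : conj A B ∈ T ↔ A ∈ T ∧ B ∈ T := by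
  simp only [conj, hT.mem_neg, hT.mem_imp]; tauto

theorem mem_disj (hT : IsMaxTheory T) : disj A B ∈ T ↔ A ∈ T ∨ B ∈ T := by
  simp only [disj, hT.mem_neg, hT.mem_imp]; tauto

theorem mem_dia (hT : IsMaxTheory T) : dia A ∈ T ↔ box (neg A) ∉ T := hT.mem_neg

end IsMaxTheory

theorem ilm_of_forall_mem {A : Form} (h : ∀ T, IsMaxTheory T → A ∈ T) : ILM A := by
  by_contra hA
  obtain ⟨M, hM, hM'⟩ := (isTheory_ilm.adjoin (neg A)).exists_max fun h' =>
    hA (.mp (.taut fun v => by simp only [neg, Holds]; tauto) h')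
  have : neg A ∈ M := hM' (.taut fun v => by simp only [Holds]; tauto)
  exact hM.mem_neg.1 this (h M hM)

/-! ### Derived rules inside maximal consistent theories -/

namespace IsMaxTheory

variable {T : Set Form} {A B C : Form}

theorem box_of_forall (hT : IsMaxTheory T) (h : ∀ U, IsMaxTheory U → A ∈ U) : box A ∈ T :=
  hT.ilm (.nec (ilm_of_forall_mem h))

theorem box_mp (hT : IsMaxTheory T) (h : box (imp A B) ∈ T) (hA : box A ∈ T) : box B ∈ T :=
  hT.mp (hT.mp (hT.ilm (.L1 A B)) h) hA

theorem box_mono (hT : IsMaxTheory T) (h : ∀ U, IsMaxTheory U → A ∈ U → B ∈ U)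
    (hA : box A ∈ T) : box B ∈ T :=
  hT.box_mp (hT.box_of_forall fun U hU => hU.mem_imp.2 (h U hU)) hA

theorem box_mono₂ (hT : IsMaxTheory T) (h : ∀ U, IsMaxTheory U → A ∈ U → B ∈ U → C ∈ U)
    (hA : box A ∈ T) (hB : box B ∈ T) : box C ∈ T :=
  hT.box_mp (hT.box_mono (fun U hU hA => hU.mem_imp.2 (h U hU hA)) hA) hB

theorem box_box (hT : IsMaxTheory T) (h : box A ∈ T) : box (box A) ∈ T :=
  hT.mp (hT.ilm (.L2 A)) h

theorem box_lob (hT : IsMaxTheory T) (h : box (imp (box A) A) ∈ T) : box A ∈ T :=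
  hT.mp (hT.ilm (.L3 A)) h

theorem rhd_of_box (hT : IsMaxTheory T) (h : box (imp A B) ∈ T) : rhd A B ∈ T :=
  hT.mp (hT.ilm (.J1 A B)) h

theorem rhd_of_forall (hT : IsMaxTheory T) (h : ∀ U, IsMaxTheory U → A ∈ U → B ∈ U) :
    rhd A B ∈ T :=
  hT.rhd_of_box (hT.box_of_forall fun U hU => hU.mem_imp.2 (h U hU))

theorem rhd_trans (hT : IsMaxTheory T) (h : rhd A B ∈ T) (h' : rhd B C ∈ T) : rhd A C ∈ T :=
  hT.mp (hT.ilm (.J2 A B C)) (hT.mem_conj.2 ⟨h, h'⟩)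

theorem rhd_disj (hT : IsMaxTheory T) (h : rhd A C ∈ T) (h' : rhd B C ∈ T) :
    rhd (disj A B) C ∈ T :=
  hT.mp (hT.ilm (.J3 A B C)) (hT.mem_conj.2 ⟨h, h'⟩)

theorem disj_dia_rhd (hT : IsMaxTheory T) : rhd (disj A (dia A)) A ∈ T :=
  hT.rhd_disj (hT.rhd_of_forall fun _ _ => id) (hT.ilm (.J5 A))

theorem rhd_montagna (hT : IsMaxTheory T) (h : rhd A B ∈ T) :
    rhd (conj A (box C)) (conj B (box C)) ∈ T :=
  hT.mp (hT.ilm (.extra ⟨A, B, C, rfl⟩)) h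

theorem box_neg_of_rhd (hT : IsMaxTheory T) (h : rhd A B ∈ T) (hB : box (neg B) ∈ T) :
    box (neg A) ∈ T := by
  have := hT.mp (hT.ilm (.J4 A B)) h
  rw [hT.mem_imp, hT.mem_dia, hT.mem_dia] at this
  tauto

theorem box_neg_bot (hT : IsMaxTheory T) : box (neg bot) ∈ T :=
  hT.box_of_forall fun _ hU => hU.mem_neg.2 hU.bot_notMem

theorem bot_rhd (hT : IsMaxTheory T) : rhd bot A ∈ T :=
  hT.rhd_of_forall fun _ hU h => (hU.bot_notMem h).elim

/-- `A ▷ A ∧ □¬A`, the consequence of Löb's axiom for `▷`. -/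
theorem rhd_conj_box_neg (hT : IsMaxTheory T) : rhd A (conj A (box (neg A))) ∈ T := by
  refine hT.rhd_trans (hT.rhd_of_forall fun U hU hA => ?_) hT.disj_dia_rhd
  rw [hU.mem_disj, hU.mem_dia, hU.mem_conj]
  by_contra! h
  -- `¬(A ∧ □¬A)` is `□¬A → ¬A`, so Löb's axiom for `¬A` yields `□¬A`.
  refine h.1 hA (hU.box_lob (hU.box_mono (fun V hV hn => ?_) h.2))
  rw [hV.mem_neg, hV.mem_conj] at hn
  rw [hV.mem_imp, hV.mem_neg]
  tauto

end IsMaxTheory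

/-! ### Critical successors -/

/-- `U` is a `C`-critical successor of `T`. -/
def Critical (T : Set Form) (C : Form) (U : Set Form) : Prop :=
  ∀ E, rhd E C ∈ T → neg E ∈ U ∧ box (neg E) ∈ U

/-- `U` is a `C`-critical successor of `T` that contains `B` as well as all boxed formulas of `Q`,
and in which `□¬B` is a newly acquired boxed formula. -/
structure Realizes (T Q : Set Form) (B C : Form) (U : Set Form) : Prop where
  max : IsMaxTheory U
  critical : Critical T C U
  mem : B ∈ U
  box_neg_mem : box (neg B) ∈ U
  box_neg_notMem : box (neg B) ∉ T
  box_mem : ∀ D, box D ∈ Q → box D ∈ U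

namespace IsMaxTheory

variable {T Q U : Set Form} {A B C : Form}

/-- From `□A` comes `¬A ▷ ⊥ ▷ C`, so criticality applies to `¬A`: critical successors are successors
in the usual modal sense. -/
theorem mem_of_box_mem_of_critical (hT : IsMaxTheory T) (hU : IsMaxTheory U)
    (h : Critical T C U) (hA : box A ∈ T) : A ∈ U ∧ box A ∈ U := by
  have hrhd : rhd (neg A) C ∈ T := hT.rhd_trans (hT.rhd_of_box (hT.box_mono
    (fun V hV hA => by rw [hV.mem_imp, hV.mem_neg]; tauto) hA)) hT.bot_rhd
  obtain ⟨h₁, h₂⟩ := h _ hrhd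
  have key : ∀ V, IsMaxTheory V → neg (neg A) ∈ V → A ∈ V := fun V hV h => by
    rwa [hV.mem_neg, hV.mem_neg, not_not] at h
  exact ⟨key U hU h₁, hU.box_mono key h₂⟩

/-- The requirements on `U` are directed: J3 merges two formulas `E` into their disjunction, and two
boxes merge into the box of a conjunction. An inconsistency thus involves one `E` and one `D`, and
gives `B ∧ □D ▷ B ∧ □D ∧ □¬(B ∧ □D) ▷ E ∨ ◇E ▷ E ▷ C`, which is excluded by hypothesis. -/
theorem exists_realizes (hT : IsMaxTheory T) (hQ : IsMaxTheory Q)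
    (h : ∀ D, box D ∈ Q → rhd (conj B (box D)) C ∉ T) : ∃ U, Realizes T Q B C U := by
  let P (E D : Form) : Form :=
    conj (conj (neg E) (box (neg E))) (conj (box D) (conj B (box (neg B))))
  have hP : ∀ {V E D}, IsMaxTheory V → (P E D ∈ V ↔
      (E ∉ V ∧ box (neg E) ∈ V) ∧ box D ∈ V ∧ B ∈ V ∧ box (neg B) ∈ V) := fun {V E D} hV => by
    simp only [P, hV.mem_conj, hV.mem_neg]
  let X : Set Form := {F | ∃ E D, rhd E C ∈ T ∧ box D ∈ Q ∧
    ∀ V, IsMaxTheory V → P E D ∈ V → F ∈ V}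
  have htop : box (neg bot) ∈ Q := hQ.box_neg_bot
  have hX : IsTheory X := by
    refine ⟨fun hF => ⟨bot, neg bot, hT.bot_rhd, htop, fun V hV _ => hV.ilm hF⟩, ?_⟩
    rintro F G ⟨E, D, hE, hD, hF⟩ ⟨E', D', hE', hD', hG⟩
    refine ⟨disj E E', conj D D', hT.rhd_disj hE hE', hQ.box_mono₂
      (fun V hV h h' => hV.mem_conj.2 ⟨h, h'⟩) hD hD', fun V hV h => ?_⟩
    rw [hP hV, hV.mem_disj] at h
    obtain ⟨⟨hn, hbn⟩, hbD, hB⟩ := h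
    refine hV.mp (hF V hV ((hP hV).2 ⟨⟨fun h => hn (.inl h), ?_⟩, ?_, hB⟩))
      (hG V hV ((hP hV).2 ⟨⟨fun h => hn (.inr h), ?_⟩, ?_, hB⟩))
    · refine hV.box_mono (fun Z hZ h => ?_) hbn
      rw [hZ.mem_neg, hZ.mem_disj] at h
      exact hZ.mem_neg.2 fun h' => h (.inl h')
    · exact hV.box_mono (fun Z hZ h => (hZ.mem_conj.1 h).1) hbD
    · refine hV.box_mono (fun Z hZ h => ?_) hbn
      rw [hZ.mem_neg, hZ.mem_disj] at h
      exact hZ.mem_neg.2 fun h' => h (.inr h')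
    · exact hV.box_mono (fun Z hZ h => (hZ.mem_conj.1 h).2) hbD
  have hbot : bot ∉ X := by
    rintro ⟨E, D, hE, hD, hF⟩
    refine h D hD (hT.rhd_trans hT.rhd_conj_box_neg (hT.rhd_trans (hT.rhd_of_forall
      fun V hV hm => ?_) (hT.rhd_trans (hT.disj_dia_rhd (A := E)) hE)))
    rw [hV.mem_conj, hV.mem_conj] at hm
    obtain ⟨⟨hB, hD⟩, hbn⟩ := hm
    rw [hV.mem_disj, hV.mem_dia]
    by_contra! hn
    refine hV.bot_notMem (hF V hV ((hP hV).2 ⟨hn, hD, hB, ?_⟩))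
    -- Since `□D` gives `□□D`, the conjunct `□D` can be dropped from `□¬(B ∧ □D)`, leaving `□¬B`.
    refine hV.box_mono₂ (fun Z hZ h h' => ?_) hbn (hV.box_box hD)
    rw [hZ.mem_neg, hZ.mem_conj] at h
    rw [hZ.mem_neg]
    tauto
  obtain ⟨U, hU, hXU⟩ := hX.exists_max hbot
  refine ⟨U, hU, fun E hE => ⟨hXU ⟨E, neg bot, hE, htop, fun V hV h => ?_⟩,
    hXU ⟨E, neg bot, hE, htop, fun V hV h => ((hP hV).1 h).1.2⟩⟩,
    hXU ⟨bot, neg bot, hT.bot_rhd, htop, fun V hV h => ((hP hV).1 h).2.2.1⟩,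
    hXU ⟨bot, neg bot, hT.bot_rhd, htop, fun V hV h => ((hP hV).1 h).2.2.2⟩, fun hn => ?_,
    fun D hD => hXU ⟨bot, D, hT.bot_rhd, hD, fun V hV h => ((hP hV).1 h).2.1⟩⟩
  · exact hV.mem_neg.2 ((hP hV).1 h).1.1
  -- Were `□¬B` in `T`, then `B ∧ □⊤ ▷ C` would hold vacuously.
  · refine h (neg bot) htop (hT.rhd_of_box (hT.box_mono (fun V hV hB => ?_) hn))
    rw [hV.mem_neg] at hB
    rw [hV.mem_imp, hV.mem_conj]
    tauto

/-- For `□D ∈ T`, L2 gives `A ▷ A ∧ □D`, so `A ∧ □D ▷ C` would yield `A ▷ C`. -/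
theorem exists_realizes_of_rhd_notMem (hT : IsMaxTheory T) (h : rhd A C ∉ T) :
    ∃ U, Realizes T T A C U := by
  refine hT.exists_realizes hT fun D hD hr => h (hT.rhd_trans (hT.rhd_of_box ?_) hr)
  refine hT.box_mono (fun V hV hD => ?_) (hT.box_box hD)
  rw [hV.mem_imp, hV.mem_conj]
  tauto

/-- Montagna's principle gives `A ∧ □D ▷ B ∧ □D`. If also `B ∧ □D ▷ C`, criticality would put `¬(A ∧
□D)` into `Q`, which contains `A` and `□D`. -/
theorem exists_realizes_of_rhd_mem (hT : IsMaxTheory T) (hQ : IsMaxTheory Q)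
    (hc : Critical T C Q) (h : rhd A B ∈ T) (hA : A ∈ Q) : ∃ U, Realizes T Q B C U := by
  refine hT.exists_realizes hQ fun D hD hr => ?_
  have := (hc _ (hT.rhd_trans (hT.rhd_montagna h) hr)).1
  rw [hQ.mem_neg, hQ.mem_conj] at this
  exact this ⟨hA, hD⟩

end IsMaxTheory

/-! ### The tree of nodes -/

/-- Nodes of the canonical tree. The node `step p y B C` is a child of `y` in the tree and an
immediate successor of `p` for the accessibility relation; it is there to make `B` true, avoiding
`C` as seen from `p`. -/
inductive Node : Type
  | root : Node
  | step : Node → Node → Form → Form → Node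

namespace Node

/-- The tree order. -/
inductive Le : Node → Node → Prop
  | refl (x : Node) : Le x x
  | step {x y : Node} (p : Node) (B C : Form) : Le x y → Le x (step p y B C)

/-- The accessibility relation. -/
def Acc (x : Node) : Node → Prop
  | root => False
  | step p _ _ _ => Le x p

/-- Distance to the root in the tree. -/
def height : Node → ℕ
  | root => 0
  | step _ y _ _ => height y + 1

theorem Le.trans {x y z : Node} (h : Le x y) (h' : Le y z) : Le x z := by
  induction h' with
  | refl => exact h
  | step p B C _ ih => exact .step p B C ih

theorem Le.eq_or_le {x p y : Node} {B C : Form} (h : Le x (.step p y B C)) :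
    x = .step p y B C ∨ Le x y := by
  cases h with
  | refl => exact .inl rfl
  | step _ _ _ h => exact .inr h

theorem Le.height_le {x y : Node} (h : Le x y) : height x ≤ height y := by
  induction h with
  | refl => exact le_rfl
  | step p B C _ ih => simp only [height]; omega

theorem not_step_le {p y : Node} {B C : Form} : ¬ Le (step p y B C) y := fun h => by
  simpa [height] using h.height_le

theorem Le.eq_of_height_le {x y : Node} (h : Le x y) (h' : height y ≤ height x) : x = y := by
  cases h with
  | refl => rfl
  | step p B C h => have := h.height_le; simp only [height] at h'; omega

theorem Le.antisymm {x y : Node} (h : Le x y) (h' : Le y x) : x = y :=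
  h.eq_of_height_le h'.height_le

theorem Le.total {x y z : Node} (h : Le x z) (h' : Le y z) : Le x y ∨ Le y x := by
  induction h with
  | refl => exact .inr h'
  | step p B C h ih =>
    rcases h'.eq_or_le with rfl | h'
    · exact .inl (.step _ _ _ h)
    · exact ih h'

/-- Two such nodes are comparable, being on one branch, and are children of the same `x`, hence
equal. So a branch determines which formula is to be avoided as seen from `x`. -/
theorem step_self_unique {x z : Node} {B C B' C' : Form} (h : Le (step x x B C) z)
    (h' : Le (step x x B' C') z) : C = C' := by
  rcases h.total h' with h | h <;> rcases h.eq_or_le with h | h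
  · exact (step.inj h).2.2.2
  · exact (not_step_le h).elim
  · exact (step.inj h).2.2.2.symm
  · exact (not_step_le h).elim

end Node

/-! ### Countability -/

/-- An injective numbering of the formulas. -/
def Form.code : Form → ℕ
  | bot => Nat.pair 0 0
  | var p => Nat.pair 1 p
  | imp A B => Nat.pair 2 (Nat.pair (code A) (code B))
  | box A => Nat.pair 3 (code A)
  | rhd A B => Nat.pair 4 (Nat.pair (code A) (code B))

theorem Form.code_injective : Function.Injective Form.code := by
  intro A
  induction A with
  | bot => intro B h; cases B <;> simp_all [code]
  | var p => intro B h; cases B <;> simp_all [code]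
  | imp A A' ih ih' =>
    intro B h
    cases B <;> simp only [code, Nat.pair_eq_pair] at h <;> try omega
    rw [ih h.2.1, ih' h.2.2]
  | box A ih =>
    intro B h
    cases B <;> simp only [code, Nat.pair_eq_pair] at h <;> try omega
    rw [ih h.2]
  | rhd A A' ih ih' =>
    intro B h
    cases B <;> simp only [code, Nat.pair_eq_pair] at h <;> try omega
    rw [ih h.2.1, ih' h.2.2]

/-- An injective numbering of the nodes. -/
def Node.code : Node → ℕ
  | root => 0
  | step p y B C => Nat.pair (Nat.pair (code p) (code y)) (Nat.pair B.code C.code) + 1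

theorem Node.code_injective : Function.Injective Node.code := by
  intro x
  induction x with
  | root => intro y h; cases y <;> simp_all [code]
  | step p y B C ih ih' =>
    intro z h
    cases z <;> simp only [code, Nat.add_right_cancel_iff, Nat.pair_eq_pair] at h
    · omega
    · rw [ih h.1.1, ih' h.1.2, Form.code_injective h.2.1, Form.code_injective h.2.2]

instance : Countable Node := Node.code_injective.countable

/-! ### The canonical model -/

namespace Node

variable {T₀ Φ : Set Form}

open Classical in
/-- The theory attached to a node of the tree with theory `T₀` at the root. -/
noncomputable def label (T₀ : Set Form) : Node → Set Form
  | root => T₀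
  | step p y B C =>
    -- The value `∅` never occurs at a world, since `IsWorld` demands realizability.
    if h : ∃ U, Realizes (label T₀ p) (label T₀ y) B C U then h.choose else ∅

/-- The nodes that belong to the canonical model; `Φ` holds the formulas that may be realized. -/
def IsWorld (T₀ Φ : Set Form) : Node → Prop
  | root => True
  | step p y B C => IsWorld T₀ Φ p ∧ IsWorld T₀ Φ y ∧ Le p y ∧ B ∈ Φ ∧
      (∃ U, Realizes (label T₀ p) (label T₀ y) B C U) ∧
      -- Once the branch passes through a node that avoids `C'` as seen from `p`, later successors
      -- created from `p` must avoid the same formula.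
      ∀ B' C', Le (step p p B' C') y → C' = C

theorem IsWorld.realizes {p y : Node} {B C : Form} (h : IsWorld T₀ Φ (step p y B C)) :
    Realizes (label T₀ p) (label T₀ y) B C (label T₀ (step p y B C)) := by
  have := h.2.2.2.2.1
  rw [label, dif_pos this]
  exact this.choose_spec

theorem IsWorld.max {x : Node} (h₀ : IsMaxTheory T₀) (h : IsWorld T₀ Φ x) :
    IsMaxTheory (label T₀ x) := by
  cases x with
  | root => exact h₀
  | step p y B C => exact h.realizes.max

theorem Le.box_mem {x y : Node} (h : Le x y) (hy : IsWorld T₀ Φ y) {D : Form}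
    (hD : box D ∈ label T₀ x) : box D ∈ label T₀ y := by
  induction h with
  | refl => exact hD
  | step p B C _ ih => exact hy.realizes.box_mem D (ih hy.2.1)

theorem Acc.le {x y : Node} (h : Acc x y) (hy : IsWorld T₀ Φ y) : Le x y := by
  cases y with
  | root => exact h.elim
  | step p y B C => exact .step _ _ _ (Le.trans h hy.2.2.1)

theorem Le.acc {x y z : Node} (h : Le x y) (h' : Acc y z) : Acc x z := by
  cases z with
  | root => exact h'.elim
  | step p z B C => exact h.trans h'

theorem Acc.mem_of_box_mem {x y : Node} (h₀ : IsMaxTheory T₀) (h : Acc x y)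
    (hy : IsWorld T₀ Φ y) {D : Form} (hD : box D ∈ label T₀ x) :
    D ∈ label T₀ y ∧ box D ∈ label T₀ y := by
  cases y with
  | root => exact h.elim
  | step p y B C =>
    exact (hy.1.max h₀).mem_of_box_mem_of_critical (hy.max h₀) hy.realizes.critical
      (Le.box_mem h hy.1 hD)

theorem Acc.critical_bot {x y : Node} (h₀ : IsMaxTheory T₀) (h : Acc x y) (hx : IsWorld T₀ Φ x)
    (hy : IsWorld T₀ Φ y) : Critical (label T₀ x) bot (label T₀ y) := fun _ hE =>
  h.mem_of_box_mem h₀ hy ((hx.max h₀).box_neg_of_rhd hE (hx.max h₀).box_neg_bot)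

/-- Write `u = step p y B' C'`. If `p` is at or above `step x x B C`, the boxes `□¬E` acquired there
persist to `p` and pass to its successor `u`. Otherwise `p = x`, and the last clause of `IsWorld`
forces `C' = C`. -/
theorem Acc.critical {x u : Node} {B C : Form} (h₀ : IsMaxTheory T₀) (h : Acc x u)
    (hu : IsWorld T₀ Φ u) (hle : Le (step x x B C) u) :
    Critical (label T₀ x) C (label T₀ u) := by
  cases hle with
  | refl => exact hu.realizes.critical
  | @step y p B' C' hle =>
    have key : Le (step x x B C) p →
        Critical (label T₀ x) C (label T₀ (step p y B' C')) := fun hp E hE => by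
      have hw : IsWorld T₀ Φ (step x x B C) := by
        have aux : ∀ {v w : Node}, Le v w → IsWorld T₀ Φ w → IsWorld T₀ Φ v := fun h hw => by
          induction h with
          | refl => exact hw
          | step _ _ _ _ ih => exact ih hw.2.1
        exact aux hp hu.1
      exact Acc.mem_of_box_mem (y := step p y B' C') h₀ hp hu (hw.realizes.critical E hE).2
    rcases hle.total hu.2.2.1 with hp | hp
    · exact key hp
    · rcases hp.eq_or_le with rfl | hp
      · exact key (.refl _)
      · obtain rfl : x = p := Le.antisymm h hp
        obtain rfl := hu.2.2.2.2.2 B C hle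
        exact hu.realizes.critical

/-- The formulas of `Φ` whose negation is necessary at a node. -/
def excluded (T₀ Φ : Set Form) (x : Node) : Set Form := {B ∈ Φ | box (neg B) ∈ label T₀ x}

/-- The formula `B` realized at `y = step p _ B C` is the new element: `□¬B` is absent at `p`, hence
also at `x`, whose boxes persist to `p`. -/
theorem Acc.excluded_ssubset {x y : Node} (h₀ : IsMaxTheory T₀) (h : Acc x y)
    (hy : IsWorld T₀ Φ y) : excluded T₀ Φ x ⊂ excluded T₀ Φ y := by
  refine ⟨fun B hB => ⟨hB.1, (h.mem_of_box_mem h₀ hy hB.2).2⟩, fun hsub => ?_⟩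
  cases y with
  | root => exact h.elim
  | step p y B C =>
    exact hy.realizes.box_neg_notMem
      (Le.box_mem h hy.1 (hsub ⟨hy.2.2.2.1, hy.realizes.box_neg_mem⟩).2)

end Node

/-! ### The canonical frame and the truth lemma -/

open Node

/-- The canonical frame. -/
def canonicalFrame {T₀ Φ : Set Form} (h₀ : IsMaxTheory T₀) (hΦ : Φ.Finite) : ILFrame where
  W := {x : Node // IsWorld T₀ Φ x}
  nonempty := ⟨root, trivial⟩
  countable := inferInstance
  R x y := Acc x.1 y.1
  S x y z := Acc x.1 y.1 ∧ Acc x.1 z.1 ∧ Le y.1 z.1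
  conv_wf U hU := by
    by_contra! h
    have hfin : ∀ x, (excluded T₀ Φ x).Finite := fun x => hΦ.subset fun _ hB => hB.1
    -- Without a maximal element, the excluded sets would outgrow the finite set `Φ`.
    have hgrow : ∀ n : ℕ, ∃ x ∈ U, n ≤ (excluded T₀ Φ x.1).ncard := fun n => by
      induction n with
      | zero => exact hU.imp fun x hx => ⟨hx, Nat.zero_le _⟩
      | succ n ih =>
        obtain ⟨x, hx, hn⟩ := ih
        obtain ⟨y, hy, hxy⟩ := h x hx
        exact ⟨y, hy, hn.trans_lt
          (Set.ncard_lt_ncard (hxy.excluded_ssubset h₀ y.2) (hfin _))⟩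
    obtain ⟨x, -, hx⟩ := hgrow (Φ.ncard + 1)
    have : (excluded T₀ Φ x.1).ncard ≤ Φ.ncard := Set.ncard_le_ncard (fun _ hB => hB.1) hΦ
    omega
  R_trans x y z hxy hyz := (hxy.le y.2).acc hyz
  S_dom _ _ _ h := ⟨h.1, h.2.1⟩
  S_refl _ _ h := ⟨h, h, .refl _⟩
  S_incl x y z hxy hyz := ⟨hxy, (hxy.le y.2).acc hyz, hyz.le z.2⟩
  S_trans _ _ _ _ h h' := ⟨h.1, h'.2.1, h.2.2.trans h'.2.2⟩

theorem canonicalFrame_isILMFrame {T₀ Φ : Set Form} (h₀ : IsMaxTheory T₀) (hΦ : Φ.Finite) :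
    (canonicalFrame h₀ hΦ).IsILMFrame :=
  fun _ _ _ _ h h' => Le.acc h.2.2 h'

/-- The formulas that have to be realized for the truth lemma to hold for a given formula. -/
def Form.seeds : Form → Set Form
  | bot => ∅
  | var _ => ∅
  | imp A B => seeds A ∪ seeds B
  | box A => insert (neg A) (seeds A)
  | rhd A B => insert A (insert B (seeds A ∪ seeds B))

theorem Form.seeds_finite (A : Form) : A.seeds.Finite := by
  induction A with
  | bot => exact Set.finite_empty
  | var => exact Set.finite_empty
  | imp A B ihA ihB => exact ihA.union ihB
  | box A ih => exact ih.insert _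
  | rhd A B ihA ihB => exact ((ihA.union ihB).insert _).insert _

theorem Node.IsWorld.exists_step {T₀ Φ : Set Form} (h₀ : IsMaxTheory T₀) {x : Node}
    (hx : IsWorld T₀ Φ x) {A C : Form} (hA : A ∈ Φ) (h : rhd A C ∉ label T₀ x) :
    IsWorld T₀ Φ (step x x A C) :=
  ⟨hx, hx, .refl _, hA, (hx.max h₀).exists_realizes_of_rhd_notMem h,
    fun _ _ h => (not_step_le h).elim⟩

theorem Node.IsWorld.exists_of_rhd_mem {T₀ Φ : Set Form} (h₀ : IsMaxTheory T₀) {x u : Node}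
    (hx : IsWorld T₀ Φ x) (hu : IsWorld T₀ Φ u) (hxu : Acc x u) {A B : Form} (hB : B ∈ Φ)
    (h : rhd A B ∈ label T₀ x) (hA : A ∈ label T₀ u) :
    ∃ C, IsWorld T₀ Φ (step x u B C) := by
  obtain ⟨C, hC, hcrit⟩ : ∃ C, (∀ B' C', Le (step x x B' C') u → C' = C) ∧
      Critical (label T₀ x) C (label T₀ u) := by
    -- If the branch below `u` avoids nothing as seen from `x`, then `⊥` serves, as every successor
    -- is `⊥`-critical.
    by_cases hex : ∃ B' C', Le (step x x B' C') u
    · obtain ⟨B', C', hle⟩ := hex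
      exact ⟨C', fun _ _ h => step_self_unique h hle, hxu.critical h₀ hu hle⟩
    · exact ⟨bot, fun B' C' h => (hex ⟨B', C', h⟩).elim, hxu.critical_bot h₀ hx hu⟩
  exact ⟨C, hx, hu, hxu.le hu, hB,
    (hx.max h₀).exists_realizes_of_rhd_mem (hu.max h₀) hcrit h hA, hC⟩

/-- The truth lemma. -/
theorem forces_canonicalFrame {T₀ Φ : Set Form} (h₀ : IsMaxTheory T₀) (hΦ : Φ.Finite) {A : Form}
    (hA : A.seeds ⊆ Φ) (x : (canonicalFrame h₀ hΦ).W) :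
    (canonicalFrame h₀ hΦ).Forces (fun x p => var p ∈ label T₀ x.1) x A ↔
      A ∈ label T₀ x.1 := by
  induction A generalizing x with
  | bot => exact ⟨False.elim, (x.2.max h₀).bot_notMem⟩
  | var p => exact Iff.rfl
  | imp A B ihA ihB =>
    rw [Form.seeds, Set.union_subset_iff] at hA
    rw [(x.2.max h₀).mem_imp, ← ihA hA.1, ← ihB hA.2]
    exact Iff.rfl
  | box A ih =>
    rw [Form.seeds, Set.insert_subset_iff] at hA
    have hx := x.2.max h₀
    refine ⟨fun h => ?_, fun h y hxy => (ih hA.2 y).2 (Acc.mem_of_box_mem h₀ hxy y.2 h).1⟩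
    by_contra hn
    -- `□A` follows from `¬A ▷ ⊥` by J4, so a failing box is treated as a failing `▷`; this is why
    -- `seeds` contains `¬A`.
    have hr : rhd (neg A) bot ∉ label T₀ x.1 := fun hr => hn <|
      hx.box_mono (fun V hV h => by rwa [hV.mem_neg, hV.mem_neg, not_not] at h)
        (hx.box_neg_of_rhd hr hx.box_neg_bot)
    have hw := x.2.exists_step h₀ hA.1 hr
    exact hw.realizes.max.mem_neg.1 hw.realizes.mem ((ih hA.2 _).1 (h ⟨_, hw⟩ (Le.refl _)))
  | rhd A B ihA ihB =>
    rw [Form.seeds, Set.insert_subset_iff, Set.insert_subset_iff, Set.union_subset_iff] at hA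
    obtain ⟨hAΦ, hBΦ, hA, hB⟩ := hA
    refine ⟨fun h => ?_, fun h u hxu hu => ?_⟩
    · by_contra hr
      have hw := x.2.exists_step h₀ hAΦ hr
      obtain ⟨v, hv, hvB⟩ := h ⟨_, hw⟩ (Le.refl _) ((ihA hA _).2 hw.realizes.mem)
      -- Criticality is applied to the trivial `B ▷ B`.
      have hcrit := Acc.critical h₀ hv.2.1 v.2 hv.2.2 B
        ((x.2.max h₀).rhd_of_forall fun _ _ => id)
      exact (v.2.max h₀).mem_neg.1 hcrit.1 ((ihB hB v).1 hvB)
    · obtain ⟨C, hC⟩ := x.2.exists_of_rhd_mem h₀ u.2 hxu hBΦ h ((ihA hA u).1 hu)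
      exact ⟨⟨_, hC⟩, ⟨hxu, Le.refl _, .step _ _ _ (.refl _)⟩, (ihB hB _).2 hC.realizes.mem⟩

theorem ilm_of_valid {A : Form} (h : ∀ F : ILFrame, F.IsILMFrame → F.Valid A) : ILM A :=
  ilm_of_forall_mem fun _ hT =>
    (forces_canonicalFrame hT A.seeds_finite subset_rfl ⟨root, trivial⟩).1
      (h _ (canonicalFrame_isILMFrame hT A.seeds_finite) _ _)

end InterpretabilityLogic

theorem theorem3p6 (A : InterpretabilityLogic.Form) :
    InterpretabilityLogic.ILM A ↔
      ∀ F : InterpretabilityLogic.ILFrame, F.IsILMFrame → F.Valid A :=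
  ⟨fun h _ hF => InterpretabilityLogic.ILFrame.valid_of_ilm hF h,
    InterpretabilityLogic.ilm_of_valid⟩
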